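/- All Lie algebras are real and finite-dimensional. A Lie algebra $\mathcal G$ is \emph{2-step solvable} if $[[u,v],[u',v']]=0$ for all $u,v,u',v'\in\mathcal G$, and \emph{Frobenius} if there is a linear form $\alpha\in\mathcal G^*$ such that the bilinear form $\partial\alpha(u,v)=-\alpha([u,v])$ is nondegenerate. For a Lie subalgebra $\mathfrak B\subseteq\mathfrak{gl}(n,\mathbb R)$ of commuting endomorphisms, $\mathfrak B\ltimes\mathbb R^n$ denotes the vector space $\mathfrak B\oplus\mathbb R^n$ with the bracket $[a,b]=[x,y]=0$, $[a,x]=ax$ for $a,b\in\mathfrak B$, $x,y\in\mathbb R^n$. An endomorphism $\psi$ of $\mathbb R^n$ is \emph{nonderogatory} if its characteristic and minimal polynomials coincide; $\mathbb R[\psi]$ is the algebra of polynomials in $\psi$ and $\mathcal G_\psi:=\mathbb R[\psi]\ltimes\mathbb R^n$. Let $E_{i,j}$ be the elementary matrices. Put $\mathfrak D_0^n:=\mathcal G_{M_0}$ with $M_0=\sum_{i=1}^{n-1}E_{i,i+1}$, and $\mathcal G_{3,1}:=\mathfrak B_{3,1}\ltimes\mathbb R^3$, where $\mathfrak B_{3,1}\subset\mathfrak{gl}(3,\mathbb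 R)$ is spanned by the identity, $E_{1,2}$ and $E_{1,3}$. For $\mathbb K=\mathbb R$ or $\mathbb C$, let $\mathfrak{aff}(\mathbb K)=\left\{\begin{pmatrix} z_1&z_2\\0&0\end{pmatrix}: z_1,z_2\in\mathbb K\right\}$ with the commutator bracket, regarded as a real Lie algebra. \textbf{Theorem.} Let $\mathcal G\neq 0$ be a 2-step solvable Frobenius Lie algebra with $\dim_{\mathbb R}\mathcal G\le 6$. Then $\dim_{\mathbb R}\mathcal G=2n$ for an integer $n$, and $\mathcal G$ is either isomorphic to $\mathcal G_\psi=\mathbb R[\psi]\ltimes\mathbb R^n$ for some nonderogatory endomorphism $\psi$ of $\mathbb R^n$, or isomorphic to $\mathcal G_{3,1}$. Consequently, $\mathcal G$ is isomorphic to one of the Lie algebras $\mathfrak{aff}(\mathbb R)$, $\mathfrak D_0^2$, $\mathfrak{aff}(\mathbb C)$, $\mathfrak D_0^3$, $\mathcal G_{3,1}$, or to one of the direct sums $\mathfrak{aff}(\mathbb R)\oplus\mathfrak{aff}(\mathbb R)$, $\mathfrak D_0^2\oplus\mathfrak{aff}(\mathbb R)$, $\mathfrak{aff}(\mathbb C)\oplus\mathfrak{aff}(\mathbb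 R)$, $\mathfrak{aff}(\mathbb R)\oplus\mathfrak{aff}(\mathbb R)\oplus\mathfrak{aff}(\mathbb R)$. -/

import Mathlib

/-! Associative rings carry the commutator bracket. -/

attribute [local instance 100] LieRing.ofAssociativeRing

/-- A Lie algebra `G` is 2-step solvable if its derived ideal is Abelian:
`⁅⁅u, v⁆, ⁅u', v'⁆⁆ = 0` for all `u, v, u', v'`. -/
def IsTwoStepSolvable (G : Type*) [LieRing G] : Prop :=
  ∀ u v u' v' : G, ⁅⁅u, v⁆, ⁅u', v'⁆⁆ = 0

/-- The Chevalley-Eilenberg coboundary `∂α(u, v) = -α(⁅u, v⁆)` of a linear form `α` on `G`,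
as a bilinear form. -/
def coboundary {G : Type*} [LieRing G] [LieAlgebra ℝ G] (α : Module.Dual ℝ G) :
    LinearMap.BilinForm ℝ G :=
  LinearMap.mk₂ ℝ (fun u v => -α ⁅u, v⁆)
    (fun u u' v => by rw [add_lie, map_add, neg_add])
    (fun c u v => by rw [smul_lie, map_smul, smul_neg])
    (fun u v v' => by rw [lie_add, map_add, neg_add])
    (fun c u v => by rw [lie_smul, map_smul, smul_neg])

/-- `G` is a Frobenius Lie algebra: some `∂α` is nondegenerate. -/
def IsFrobeniusLie (G : Type*) [LieRing G] [LieAlgebra ℝ G] : Prop :=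
  ∃ α : Module.Dual ℝ G, (coboundary α).Nondegenerate

/-- The Lie bracket that Mathlib puts on `ℝⁿ` (the commutator for the coordinatewise product)
is zero. -/
theorem lie_pi_eq_zero {n : ℕ} (x y : Fin n → ℝ) : ⁅x, y⁆ = 0 := by
  rw [Ring.lie_def, mul_comm, sub_self]

/-- The natural action `(a, x) ↦ a x` of a Lie subalgebra `B` of `gl(ℝⁿ)` on the Abelian Lie
algebra `ℝⁿ`. -/
def naturalAction {n : ℕ} (B : LieSubalgebra ℝ (Module.End ℝ (Fin n → ℝ))) :
    B →ₗ⁅ℝ⁆ LieDerivation ℝ (Fin n → ℝ) (Fin n → ℝ) where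
  toFun a :=
    { toLinearMap := (a : Module.End ℝ (Fin n → ℝ))
      leibniz' := fun x y => by simp only [lie_pi_eq_zero, map_zero, sub_self] }
  map_add' _ _ := rfl
  map_smul' _ _ := rfl
  map_lie' {a b} := by
    ext x
    simp [Ring.lie_def]

/-- The semidirect sum `B ⋉ ℝⁿ`, with `⁅x, y⁆ = 0` and `⁅a, x⁆ = a x` for `a` in `B` and `x, y` in
`ℝⁿ`, and with the commutator as bracket on `B`. -/
abbrev SemidirectRn {n : ℕ} (B : LieSubalgebra ℝ (Module.End ℝ (Fin n → ℝ))) : Type :=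
  LieAlgebra.SemiDirectSum (Fin n → ℝ) B (naturalAction B)

/-- The algebra `ℝ[ψ]` of polynomials in `ψ`, as a Lie subalgebra of `gl(ℝⁿ)`. -/
def polyLie {n : ℕ} (ψ : Module.End ℝ (Fin n → ℝ)) :
    LieSubalgebra ℝ (Module.End ℝ (Fin n → ℝ)) :=
  lieSubalgebraOfSubalgebra ℝ (Module.End ℝ (Fin n → ℝ)) (Algebra.adjoin ℝ {ψ})

/-- `𝒢_ψ = ℝ[ψ] ⋉ ℝⁿ`. -/
abbrev GPoly {n : ℕ} (ψ : Module.End ℝ (Fin n → ℝ)) : Type :=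
  SemidirectRn (polyLie ψ)

/-- `ψ` is nonderogatory: its characteristic and minimal polynomials coincide. -/
def IsNonderogatory {n : ℕ} (ψ : Module.End ℝ (Fin n → ℝ)) : Prop :=
  ψ.charpoly = minpoly ℝ ψ

/-- The endomorphism of `ℝⁿ` with matrix `E_{1,2} + E_{2,3} + ⋯ + E_{n-1,n}`. -/
def principalNilpotent (n : ℕ) : Module.End ℝ (Fin n → ℝ) :=
  Matrix.toLin' (Matrix.of fun i j : Fin n => if (i : ℕ) + 1 = (j : ℕ) then (1 : ℝ) else 0)

/-- `𝔇₀ⁿ = ℝ[M₀] ⋉ ℝⁿ` for the principal nilpotent matrix `M₀`. -/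
abbrev DZero (n : ℕ) : Type :=
  GPoly (principalNilpotent n)

/-- The real Lie algebra `aff(K)` of the group of affine motions of the line `K` (here `K` is `ℝ`
or `ℂ`): the matrices with entries in `K` and rows `(z₁, z₂)`, `(0, 0)`, under the commutator. -/
def aff (K : Type) [Field K] [Algebra ℝ K] : LieSubalgebra ℝ (Matrix (Fin 2) (Fin 2) K) where
  carrier := {A | ∀ j, A 1 j = 0}
  zero_mem' := fun _ => rfl
  add_mem' := fun {A B} hA hB j => by rw [Matrix.add_apply, hA, hB, add_zero]
  smul_mem' := fun c A hA j => by rw [Matrix.smul_apply, hA, smul_zero]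
  lie_mem' := fun {A B} hA hB j => by
    rw [Ring.lie_def, Matrix.sub_apply, Matrix.mul_apply, Matrix.mul_apply,
      Finset.sum_eq_zero fun k _ => by rw [hA, zero_mul],
      Finset.sum_eq_zero fun k _ => by rw [hB, zero_mul], sub_zero]

/-- `𝔅_{3,1}`, the span of the identity, `E_{1,2}` and `E_{1,3}` in `gl(ℝ³)`. -/
def B31 : LieSubalgebra ℝ (Module.End ℝ (Fin 3 → ℝ)) where
  toSubmodule := Submodule.span ℝ
    {1, Matrix.toLin' (Matrix.single (0 : Fin 3) (1 : Fin 3) (1 : ℝ)),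
      Matrix.toLin' (Matrix.single (0 : Fin 3) (2 : Fin 3) (1 : ℝ))}
  lie_mem' := fun {a b} ha hb => by
    obtain ⟨x, y, z, rfl⟩ := Submodule.mem_span_triple.1 ha
    obtain ⟨x', y', z', rfl⟩ := Submodule.mem_span_triple.1 hb
    have h : ∀ i j : Fin 3, i ≠ 0 →
        Matrix.toLin' (Matrix.single (0 : Fin 3) i (1 : ℝ)) *
          Matrix.toLin' (Matrix.single (0 : Fin 3) j (1 : ℝ)) = 0 := by
      intro i j hi
      rw [Module.End.mul_eq_comp, ← Matrix.toLin'_mul, Matrix.single_mul_single_of_ne _ _ _ _ hi,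
        map_zero]
    have h11 := h 1 1 (by decide)
    have h12 := h 1 2 (by decide)
    have h21 := h 2 1 (by decide)
    have h22 := h 2 2 (by decide)
    generalize Matrix.toLin' (Matrix.single (0 : Fin 3) (1 : Fin 3) (1 : ℝ)) = p at *
    generalize Matrix.toLin' (Matrix.single (0 : Fin 3) (2 : Fin 3) (1 : ℝ)) = q at *
    suffices h0 : ⁅x • 1 + y • p + z • q, x' • 1 + y' • p + z' • q⁆ = 0 by
      rw [h0]
      exact Submodule.zero_mem _
    simp only [Ring.lie_def, mul_add, add_mul, smul_mul_assoc, mul_smul_comm, one_mul, mul_one,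
      h11, h12, h21, h22, smul_zero]
    module

/-- `𝒢_{3,1} = 𝔅_{3,1} ⋉ ℝ³`. -/
abbrev G31 : Type :=
  SemidirectRn B31

/-! Fix `α` with `∂α` nondegenerate and let `e` be its principal element, defined by `α ⁅e, v⁆ = α
v`. Since the derived ideal is Abelian, `ad e` is the identity on it, so `ad e` is a projection and
`G = H ⊕ V` with `H = ker (ad e)` and `V = ⁅G, G⁆`, both Abelian. Nondegeneracy makes `(h, v) ↦ α
⁅h, v⁆` a perfect pairing of `H` with `V`. The operators by which `H` acts on `V` commute, include
the identity, and are closed under composition, because every form `α ∘ ad a ∘ ad b` equals some `α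
∘ ad c`. They thus form a commutative unital algebra `A ≅ H`, and the pairing identifies `V` with
`A*` as an `A`-module (`exists_isCotangent`).

So `G ≅ A ⋉ A*` depends only on `A`, with `dim G = 2 dim A`, and products of algebras become direct
sums of Lie algebras. It remains to list the real commutative algebras of dimension at most 3: `ℝ`;
`ℝ × ℝ`, `ℂ`, `ℝ[x]/(x²)`; a product of a 2-dimensional one with `ℝ`; `ℝ[x]/(x³)`; `ℝ[x, y]/(x,
y)²`. All but the last have a single generator, whose action on `A*` is a nonderogatory `ψ`; the
last gives `G31`. -/

/-! ### Cotangent sums `A ⋉ A*` -/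

/-- The action of an element `a` of an algebra `A` on the dual of `A`, transpose to left
multiplication by `a`. -/
def dualMulLeft {A : Type*} [Ring A] [Algebra ℝ A] (a : A) :
    Module.Dual ℝ A →ₗ[ℝ] Module.Dual ℝ A :=
  (LinearMap.mulLeft ℝ a).dualMap

theorem dualMulLeft_apply {A : Type*} [Ring A] [Algebra ℝ A] (a : A) (f : Module.Dual ℝ A)
    (x : A) : dualMulLeft a f x = f (a * x) := rfl

/-- `G` is the semidirect sum of the Abelian Lie algebras `A` and `A*` for the natural action of
the algebra `A` on its dual. -/
def IsCotangent (G : Type*) [LieRing G] [LieAlgebra ℝ G] (A : Type*) [Ring A] [Algebra ℝ A] :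
    Prop :=
  ∃ e : (A × Module.Dual ℝ A) ≃ₗ[ℝ] G, ∀ (a b : A) (f g : Module.Dual ℝ A),
    ⁅e (a, f), e (b, g)⁆ = e (0, dualMulLeft a g - dualMulLeft b f)

theorem IsCotangent.nonempty_lieEquiv {G G' A : Type*} [LieRing G] [LieAlgebra ℝ G]
    [LieRing G'] [LieAlgebra ℝ G'] [Ring A] [Algebra ℝ A]
    (h : IsCotangent G A) (h' : IsCotangent G' A) : Nonempty (G ≃ₗ⁅ℝ⁆ G') := by
  obtain ⟨e, he⟩ := h
  obtain ⟨e', he'⟩ := h'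
  refine ⟨{ e.symm.trans e' with map_lie' := ?_ }⟩
  intro x y
  obtain ⟨⟨a, f⟩, rfl⟩ := e.surjective x
  obtain ⟨⟨b, g⟩, rfl⟩ := e.surjective y
  simp [he, he']

theorem IsCotangent.congr {G A A' : Type*} [LieRing G] [LieAlgebra ℝ G] [Ring A] [Algebra ℝ A]
    [Ring A'] [Algebra ℝ A'] (h : IsCotangent G A) (φ : A ≃ₐ[ℝ] A') : IsCotangent G A' := by
  obtain ⟨e, he⟩ := h
  refine ⟨(φ.symm.toLinearEquiv.prodCongr φ.toLinearEquiv.dualMap).trans e, ?_⟩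
  intro a b f g
  have key : ∀ (a : A') (f : Module.Dual ℝ A'), φ.toLinearEquiv.dualMap (dualMulLeft a f) =
      dualMulLeft (φ.symm a) (φ.toLinearEquiv.dualMap f) := by
    intro a f
    ext x
    simp [dualMulLeft_apply]
  simp [he, key]

/-- The dual of `A × A'` splits as `A* × A'*`, and each factor of the algebra acts only on its own
summand. -/
theorem IsCotangent.prod {G G' A A' : Type*} [LieRing G] [LieAlgebra ℝ G]
    [LieRing G'] [LieAlgebra ℝ G'] [Ring A] [Algebra ℝ A] [Ring A'] [Algebra ℝ A']
    (h : IsCotangent G A) (h' : IsCotangent G' A') : IsCotangent (G × G') (A × A') := by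
  obtain ⟨e, he⟩ := h
  obtain ⟨e', he'⟩ := h'
  let d := (Module.dualProdDualEquivDual ℝ A A').symm
  have hd1 : ∀ f x, (d f).1 x = f (x, 0) := fun _ _ => rfl
  have hd2 : ∀ f x, (d f).2 x = f (0, x) := fun _ _ => rfl
  refine ⟨((LinearEquiv.refl ℝ (A × A')).prodCongr d).trans
    ((LinearEquiv.prodProdProdComm ℝ A A' _ _).trans (e.prodCongr e')), ?_⟩
  rintro ⟨a, a'⟩ ⟨b, b'⟩ f g
  have key1 : ∀ (a : A) (a' : A') f, (d (dualMulLeft (a, a') f)).1 = dualMulLeft a (d f).1 := by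
    intro a a' f
    ext x
    simp [dualMulLeft_apply, hd1]
  have key2 : ∀ (a : A) (a' : A') f, (d (dualMulLeft (a, a') f)).2 = dualMulLeft a' (d f).2 := by
    intro a a' f
    ext x
    simp [dualMulLeft_apply, hd2]
  simp [he, he', key1, key2, LieAlgebra.Prod.bracket_apply]

theorem IsCotangent.finrank_eq {G A : Type*} [LieRing G] [LieAlgebra ℝ G] [Ring A]
    [Algebra ℝ A] [FiniteDimensional ℝ A] (h : IsCotangent G A) :
    Module.finrank ℝ G = 2 * Module.finrank ℝ A := by
  obtain ⟨e, -⟩ := h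
  rw [← e.finrank_eq, Module.finrank_prod, Subspace.dual_finrank_eq, two_mul]

/-- A faithful semidirect sum `A ⋉ V` with a Frobenius form is the cotangent sum of `A`. -/
theorem IsCotangent.of_pairing {G A V : Type*} [LieRing G] [LieAlgebra ℝ G] [Ring A]
    [Algebra ℝ A] [AddCommGroup V] [Module ℝ V] [FiniteDimensional ℝ A] [FiniteDimensional ℝ V]
    (hA : ∀ a b : A, a * b = b * a) (ρ : A →ₐ[ℝ] Module.End ℝ V) (e : (A × V) ≃ₗ[ℝ] G)
    (he : ∀ a b v w, ⁅e (a, v), e (b, w)⁆ = e (0, ρ a w - ρ b v)) (α : Module.Dual ℝ V)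
    (hV : ∀ v, (∀ a, α (ρ a v) = 0) → v = 0) (hA' : ∀ a, (∀ v, α (ρ a v) = 0) → a = 0) :
    IsCotangent G A := by
  let pair : V →ₗ[ℝ] Module.Dual ℝ A := LinearMap.mk₂ ℝ
    (fun v a => α (ρ a v)) (by simp) (by simp) (by simp) (by simp)
  have hpair : ∀ v a, pair v a = α (ρ a v) := fun _ _ => rfl
  have hinj : Function.Injective pair := (injective_iff_map_eq_zero pair).2 fun v hv =>
    hV v fun a => LinearMap.congr_fun hv a
  have hinj' : Function.Injective pair.flip := (injective_iff_map_eq_zero pair.flip).2 fun a ha =>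
    hA' a fun v => LinearMap.congr_fun ha v
  -- The pairing embeds `V` in `A*` and `A` in `V*`, so the dimensions agree and both embeddings are
  -- onto.
  have hdim : Module.finrank ℝ V = Module.finrank ℝ (Module.Dual ℝ A) := by
    refine le_antisymm (LinearMap.finrank_le_finrank_of_injective hinj) ?_
    rw [Subspace.dual_finrank_eq, ← Subspace.dual_finrank_eq (V := V)]
    exact LinearMap.finrank_le_finrank_of_injective hinj'
  let eV : V ≃ₗ[ℝ] Module.Dual ℝ A := LinearEquiv.ofInjectiveOfFinrankEq pair hinj hdim
  have heV : ∀ v a, eV v a = α (ρ a v) := fun _ _ => rfl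
  have hequiv : ∀ a v, eV (ρ a v) = dualMulLeft a (eV v) := by
    intro a v
    ext b
    rw [dualMulLeft_apply, heV, heV, hA, map_mul]
    rfl
  refine ⟨((LinearEquiv.refl ℝ A).prodCongr eV.symm).trans e, ?_⟩
  intro a b f g
  obtain ⟨v, rfl⟩ := eV.surjective f
  obtain ⟨w, rfl⟩ := eV.surjective g
  rw [← hequiv, ← hequiv, ← map_sub]
  simp [he]

/-! ### From a Frobenius form to a commutative algebra -/

section Structure

variable {G : Type*} [LieRing G] [LieAlgebra ℝ G]

theorem eq_zero_of_coboundary {α : Module.Dual ℝ G} (hα : (coboundary α).Nondegenerate) {v : G}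
    (h : ∀ u : G, α ⁅u, v⁆ = 0) : v = 0 :=
  hα.2 v fun u => by simp [coboundary, h u]

/-- For `w = ⁅x, y⁆`, `ad e` and `ad u` commute on `w` because `⁅⁅u, e⁆, w⁆ = 0`. Hence `α ⁅u, ⁅e,
w⁆ - w⁆ = 0` for every `u`. -/
theorem principal_element_lie {α : Module.Dual ℝ G} (hsolv : IsTwoStepSolvable G)
    (hα : (coboundary α).Nondegenerate) {e : G} (he : ∀ v, α ⁅e, v⁆ = α v) (x y : G) :
    ⁅e, ⁅x, y⁆⁆ = ⁅x, y⁆ := by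
  rw [← sub_eq_zero]
  refine eq_zero_of_coboundary hα fun u => ?_
  have h1 : ⁅u, ⁅e, ⁅x, y⁆⁆⁆ = ⁅e, ⁅u, ⁅x, y⁆⁆⁆ := by
    rw [leibniz_lie u e, hsolv, zero_add]
  rw [lie_sub, h1, map_sub, he, sub_self]

theorem exists_lie_form_eq [FiniteDimensional ℝ G] {α : Module.Dual ℝ G}
    (hα : (coboundary α).Nondegenerate) (β : Module.Dual ℝ G) : ∃ u : G, ∀ v, α ⁅u, v⁆ = β v := by
  obtain ⟨u, hu⟩ := ((coboundary α).toDual hα).surjective (-β)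
  refine ⟨u, fun v => ?_⟩
  have := LinearMap.congr_fun hu v
  simpa [LinearMap.BilinForm.toDual_def, coboundary] using this

/-- A 2-step solvable Frobenius Lie algebra is the cotangent sum of a commutative algebra. -/
theorem exists_isCotangent {G : Type*} [LieRing G] [LieAlgebra ℝ G] [FiniteDimensional ℝ G]
    (hsolv : IsTwoStepSolvable G) (hfrob : IsFrobeniusLie G) :
    ∃ (B : Submodule ℝ G) (A : Subalgebra ℝ (Module.End ℝ B)),
      (∀ a b : A, a * b = b * a) ∧ IsCotangent G A := by
  obtain ⟨α, hα⟩ := hfrob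
  obtain ⟨e, he⟩ := exists_lie_form_eq hα α
  have hee := principal_element_lie hsolv hα he
  let V : Submodule ℝ G := LinearMap.range (LieAlgebra.ad ℝ G e : G →ₗ[ℝ] G)
  let H : Submodule ℝ G := LinearMap.ker (LieAlgebra.ad ℝ G e : G →ₗ[ℝ] G)
  have hVe : ∀ v ∈ V, ⁅e, v⁆ = v := by
    rintro _ ⟨x, rfl⟩
    exact hee e x
  have hHe : ∀ h ∈ H, ⁅e, h⁆ = 0 := fun h hh => hh
  have hV : ∀ x y : G, ⁅x, y⁆ ∈ V := fun x y => ⟨⁅x, y⁆, hee x y⟩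
  have hVV : ∀ v ∈ V, ∀ w ∈ V, ⁅v, w⁆ = 0 := by
    rintro _ ⟨x, rfl⟩ _ ⟨y, rfl⟩
    exact hsolv _ _ _ _
  -- `ad e` fixes `⁅h, k⁆`, as it fixes every bracket, but kills it by the Leibniz rule.
  have hHH : ∀ h ∈ H, ∀ k ∈ H, ⁅h, k⁆ = 0 := by
    intro h hh k hk
    rw [← hee h k, leibniz_lie, hHe h hh, hHe k hk, zero_lie, lie_zero, add_zero]
  have hcompl : IsCompl H V := by
    rw [isCompl_iff, disjoint_iff, codisjoint_iff]
    constructor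
    · rw [eq_bot_iff]
      rintro x ⟨hx1, hx2⟩
      rw [Submodule.mem_bot, ← hVe x hx2, hHe x hx1]
    · rw [eq_top_iff]
      intro x _
      rw [← sub_add_cancel x ⁅e, x⁆]
      refine Submodule.add_mem_sup ?_ (hV e x)
      change ⁅e, x - ⁅e, x⁆⁆ = 0
      rw [lie_sub, hee, sub_self]
  have hdecomp : ∀ x : G, ∃ h : H, ∃ v : V, (h : G) + v = x := by
    intro x
    obtain ⟨h, hh, v, hv, hx⟩ := Submodule.mem_sup.1 (hcompl.sup_eq_top ▸ Submodule.mem_top (x := x))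
    exact ⟨⟨h, hh⟩, ⟨v, hv⟩, hx⟩
  have hcomm : ∀ x y : G, ∀ v ∈ V, ⁅x, ⁅y, v⁆⁆ = ⁅y, ⁅x, v⁆⁆ := by
    intro x y v hv
    rw [leibniz_lie x y v, hVV _ (hV x y) v hv, zero_add]
  let act : H →ₗ[ℝ] Module.End ℝ V := LinearMap.mk₂ ℝ
    (fun h v => (⟨⁅(h : G), (v : G)⁆, hV _ _⟩ : V))
    (fun _ _ _ => Subtype.ext (add_lie _ _ _)) (fun _ _ _ => Subtype.ext (smul_lie _ _ _))
    (fun _ _ _ => Subtype.ext (lie_add _ _ _)) (fun _ _ _ => Subtype.ext (lie_smul _ _ _))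
  have hact : ∀ h v, (act h v : G) = ⁅(h : G), (v : G)⁆ := fun _ _ => rfl
  have hone : act ⟨e, lie_self e⟩ = 1 := by
    ext v
    exact hVe v v.2
  -- The element `c` represents the form `α ∘ ad a ∘ ad b`. Its `V`-component acts trivially on `V`,
  -- so its `H`-component `h` is the candidate for the product.
  have hmul : ∀ a b : H, ∃ c : H, act c = act a * act b := by
    intro a b
    obtain ⟨c, hc⟩ := exists_lie_form_eq hα
      (α ∘ₗ (LieAlgebra.ad ℝ G a : G →ₗ[ℝ] G) ∘ₗ (LieAlgebra.ad ℝ G b : G →ₗ[ℝ] G))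
    simp only [LinearMap.comp_apply, LieAlgebra.ad_apply] at hc
    obtain ⟨h, w, rfl⟩ := hdecomp c
    refine ⟨h, ?_⟩
    ext v
    have hv : ∀ v ∈ V, α ⁅(h : G), v⁆ = α ⁅(a : G), ⁅(b : G), v⁆⁆ := by
      intro v hv
      rw [← hc, add_lie, hVV w w.2 v hv, add_zero]
    change ⁅(h : G), (v : G)⁆ = ⁅(a : G), ⁅(b : G), (v : G)⁆⁆
    rw [← sub_eq_zero]
    -- All `ad`s commute on `V`, so `ad u` can be moved innermost; the identity under `α` then
    -- applies to `⁅u, v⁆`.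
    refine eq_zero_of_coboundary hα fun u => ?_
    rw [lie_sub, hcomm u h v v.2, hcomm u a _ (hV _ _), hcomm u b v v.2, map_sub, hv _ (hV _ _),
      sub_self]
  have hcomm' : ∀ a b : H, act a * act b = act b * act a := by
    intro a b
    ext v
    exact hcomm a b v v.2
  let A : Subalgebra ℝ (Module.End ℝ V) :=
    { carrier := LinearMap.range act
      zero_mem' := zero_mem _
      add_mem' := fun ha hb => add_mem ha hb
      one_mem' := ⟨_, hone⟩
      mul_mem' := by
        rintro _ _ ⟨a, rfl⟩ ⟨b, rfl⟩
        exact hmul a b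
      algebraMap_mem' := fun r => by
        rw [Algebra.algebraMap_eq_smul_one]
        exact Submodule.smul_mem _ r ⟨_, hone⟩ }
  have hA : ∀ a : A, ∃ h : H, act h = a := fun a => a.2
  have hAcomm : ∀ a b : A, a * b = b * a := by
    intro a b
    obtain ⟨h, hh⟩ := hA a
    obtain ⟨k, hk⟩ := hA b
    refine Subtype.ext ?_
    rw [MulMemClass.coe_mul, MulMemClass.coe_mul, ← hh, ← hk, hcomm']
  refine ⟨V, A, hAcomm, ?_⟩
  have hHinj : ∀ h : H, (∀ v ∈ V, α ⁅(h : G), v⁆ = 0) → h = 0 := by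
    intro h hh
    refine Subtype.ext (eq_zero_of_coboundary hα fun u => ?_)
    obtain ⟨k, v, rfl⟩ := hdecomp u
    rw [← lie_skew, map_neg, lie_add, hHH h h.2 k k.2, zero_add, hh v v.2, neg_zero]
  have hVinj : ∀ v : V, (∀ h ∈ H, α ⁅h, (v : G)⁆ = 0) → v = 0 := by
    intro v hv
    refine Subtype.ext (eq_zero_of_coboundary hα fun u => ?_)
    obtain ⟨k, w, rfl⟩ := hdecomp u
    rw [add_lie, hVV w w.2 v v.2, add_zero, hv k k.2]
  let actA : H →ₗ[ℝ] A := 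
    { toFun := fun h => ⟨act h, h, rfl⟩
      map_add' := fun _ _ => Subtype.ext (map_add _ _ _)
      map_smul' := fun _ _ => Subtype.ext (map_smul _ _ _) }
  let eA : H ≃ₗ[ℝ] A := LinearEquiv.ofBijective actA (by
    constructor
    · refine (injective_iff_map_eq_zero actA).2 fun h hh => ?_
      refine hHinj h fun v hv => ?_
      have h1 : act h = 0 := congrArg Subtype.val hh
      have h2 : (act h ⟨v, hv⟩ : G) = 0 := by rw [h1]; rfl
      rw [← hact h ⟨v, hv⟩, h2, map_zero]
    · rintro ⟨_, h, rfl⟩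
      exact ⟨h, rfl⟩)
  have : FiniteDimensional ℝ A := Module.Finite.equiv eA
  have heA : ∀ h, (eA h : Module.End ℝ V) = act h := fun _ => rfl
  have hVH : ∀ h : H, ∀ v : V, ∀ k : H, ∀ w : V, ⁅(h : G) + v, (k : G) + w⁆ =
      ⁅(h : G), (w : G)⁆ - ⁅(k : G), (v : G)⁆ := by
    intro h v k w
    rw [add_lie, lie_add, lie_add, hHH h h.2 k k.2, hVV v v.2 w w.2, ← lie_skew (k : G)]
    abel
  have hz : eA.symm 0 = 0 := eA.symm.map_zero
  refine .of_pairing hAcomm A.val ((eA.symm.prodCongr (LinearEquiv.refl ℝ V)).trans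
    (Submodule.prodEquivOfIsCompl H V hcompl)) ?_ (α ∘ₗ V.subtype) ?_ ?_
  · intro a b v w
    obtain ⟨h, rfl⟩ := eA.surjective a
    obtain ⟨k, rfl⟩ := eA.surjective b
    simp only [LinearEquiv.trans_apply, LinearEquiv.prodCongr_apply, LinearEquiv.refl_apply,
      LinearEquiv.symm_apply_apply, Submodule.coe_prodEquivOfIsCompl', hz,
      Submodule.coe_zero, zero_add, hVH]
    rfl
  · exact fun v hv => hVinj v fun h hh => hv (eA ⟨h, hh⟩)
  · intro a ha
    obtain ⟨h, rfl⟩ := eA.surjective a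
    rw [hHinj h fun v hv => ha ⟨v, hv⟩]
    exact eA.map_zero

end Structure

/-! ### The affine algebras -/

/-- The linear equivalence from pairs in `K` to `aff K`. -/
def affEquiv (K : Type) [Field K] [Algebra ℝ K] : (K × K) ≃ₗ[ℝ] aff K where
  toFun p := ⟨!![p.1, p.2; 0, 0], fun j => by fin_cases j <;> rfl⟩
  invFun M := (M.1 0 0, M.1 0 1)
  map_add' p q := Subtype.ext (by ext i j; fin_cases i <;> fin_cases j <;> simp)
  map_smul' c p := Subtype.ext (by ext i j; fin_cases i <;> fin_cases j <;> simp)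
  left_inv p := rfl
  right_inv M := Subtype.ext (by
    have := M.2
    ext i j; fin_cases i <;> fin_cases j <;> simp [this 0, this 1])

/-- In a field, a nonzero `v` is detected by its inverse: `α (v⁻¹ * v) = α 1 ≠ 0`. -/
theorem isCotangent_aff (K : Type) [Field K] [Algebra ℝ K] [FiniteDimensional ℝ K]
    (α : Module.Dual ℝ K) (hα : α 1 ≠ 0) : IsCotangent (aff K) K := by
  refine .of_pairing mul_comm (Algebra.lmul ℝ K) (affEquiv K) ?_ α ?_ ?_
  · intro a b v w
    refine Subtype.ext ?_
    change ⁅!![a, v; 0, 0], !![b, w; 0, 0]⁆ = !![0, a * w - b * v; 0, 0]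
    rw [Ring.lie_def]
    ext i j
    fin_cases i <;> fin_cases j <;> simp [mul_comm]
  · intro v hv
    by_contra h
    exact hα (by simpa [h] using hv v⁻¹)
  · intro v hv
    by_contra h
    exact hα (by simpa [h] using hv v⁻¹)

/-! ### Matrix models of `A ⋉ A*` -/

section CoordinateModel

variable {A : Type*} [CommRing A] [Algebra ℝ A]

/-- The representation of a commutative algebra on its dual. -/
def dualRep (A : Type*) [CommRing A] [Algebra ℝ A] :
    A →ₐ[ℝ] Module.End ℝ (Module.Dual ℝ A) :=
  AlgHom.ofLinearMap
    { toFun := dualMulLeft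
      map_add' := fun a b => by ext f x; simp [dualMulLeft_apply, add_mul]
      map_smul' := fun c a => by ext f x; simp [dualMulLeft_apply] }
    (by ext f x; simp [dualMulLeft_apply])
    (fun a b => by
      ext f x
      simp only [LinearMap.coe_mk, AddHom.coe_mk, Module.End.mul_apply, dualMulLeft_apply]
      congr 1
      ring)

theorem dualRep_apply (a : A) (f : Module.Dual ℝ A) : dualRep A a f = dualMulLeft a f := rfl

theorem dualRep_injective : Function.Injective (dualRep A) := by
  refine (injective_iff_map_eq_zero _).2 fun a ha => ?_
  refine (Module.forall_dual_apply_eq_zero_iff ℝ a).1 fun f => ?_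
  have := LinearMap.congr_fun (LinearMap.congr_fun ha f) 1
  simpa [dualRep_apply, dualMulLeft_apply] using this

/-- The representation of `A` on its dual, in coordinates given by `b`. -/
def coordRep {n : ℕ} (b : Module.Dual ℝ A ≃ₗ[ℝ] (Fin n → ℝ)) :
    A →ₐ[ℝ] Module.End ℝ (Fin n → ℝ) :=
  (b.conjAlgEquiv ℝ).toAlgHom.comp (dualRep A)

theorem coordRep_apply {n : ℕ} (b : Module.Dual ℝ A ≃ₗ[ℝ] (Fin n → ℝ)) (a : A)
    (f : Module.Dual ℝ A) : coordRep b a (b f) = b (dualMulLeft a f) := by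
  simp [coordRep, LinearEquiv.conjAlgEquiv, dualRep_apply]

theorem coordRep_injective {n : ℕ} (b : Module.Dual ℝ A ≃ₗ[ℝ] (Fin n → ℝ)) :
    Function.Injective (coordRep b) :=
  (b.conjAlgEquiv ℝ).injective.comp dualRep_injective

theorem isCotangent_semidirectRn {n : ℕ} (b : Module.Dual ℝ A ≃ₗ[ℝ] (Fin n → ℝ))
    (B : LieSubalgebra ℝ (Module.End ℝ (Fin n → ℝ))) (hB : ∀ x, x ∈ B ↔ ∃ a, coordRep b a = x) :
    IsCotangent (SemidirectRn B) A := by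
  let r : A →ₗ[ℝ] B :=
    { toFun := fun a => ⟨coordRep b a, (hB _).2 ⟨a, rfl⟩⟩
      map_add' := fun _ _ => Subtype.ext (map_add _ _ _)
      map_smul' := fun _ _ => Subtype.ext (map_smul _ _ _) }
  have hr : ∀ a, (r a : Module.End ℝ (Fin n → ℝ)) = coordRep b a := fun _ => rfl
  let e : A ≃ₗ[ℝ] B := LinearEquiv.ofBijective r (by
    constructor
    · intro x y h
      exact coordRep_injective b (congrArg Subtype.val h)
    · rintro ⟨x, hx⟩
      obtain ⟨a, rfl⟩ := (hB x).1 hx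
      exact ⟨a, rfl⟩)
  have he : ∀ a, (e a : Module.End ℝ (Fin n → ℝ)) = coordRep b a := fun _ => rfl
  refine ⟨((LinearEquiv.prodComm ℝ A _).trans (b.prodCongr e)).trans
    (LieAlgebra.SemiDirectSum.toProdl (naturalAction B)).symm, ?_⟩
  intro a a' f f'
  change (⟨⁅b f, b f'⁆ + coordRep b a (b f') - coordRep b a' (b f), ⁅e a, e a'⁆⟩ :
    SemidirectRn B) = ⟨b (dualMulLeft a f' - dualMulLeft a' f), e 0⟩
  have h1 : ⁅e a, e a'⁆ = e 0 := by
    refine Subtype.ext ?_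
    rw [LieSubalgebra.coe_bracket, he, he, he, Ring.lie_def, ← map_mul, ← map_mul, mul_comm,
      sub_self, map_zero]
  rw [h1, lie_pi_eq_zero, coordRep_apply, coordRep_apply, zero_add, map_sub]

theorem isCotangent_gPoly {n : ℕ} (b : Module.Dual ℝ A ≃ₗ[ℝ] (Fin n → ℝ)) {x : A}
    (hx : Algebra.adjoin ℝ {x} = ⊤) : IsCotangent (GPoly (coordRep b x)) A := by
  refine isCotangent_semidirectRn b _ fun y => ?_
  change y ∈ Algebra.adjoin ℝ {coordRep b x} ↔ _
  rw [← Set.image_singleton, ← AlgHom.map_adjoin, hx, Algebra.map_top, AlgHom.mem_range]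

/-- Coordinates on the dual of an algebra with a basis of powers. -/
noncomputable def PowerBasis.dualCoords (pb : PowerBasis ℝ A) :
    Module.Dual ℝ A ≃ₗ[ℝ] (Fin pb.dim → ℝ) :=
  (pb.basis.constr ℝ).symm

theorem PowerBasis.dualCoords_apply (pb : PowerBasis ℝ A) (f : Module.Dual ℝ A)
    (i : Fin pb.dim) : pb.dualCoords f i = f (pb.gen ^ (i : ℕ)) := by
  rw [← pb.basis_eq_pow]; rfl

/-- A faithful representation preserves the minimal polynomial, which for a generator has degree
`dim A = n`, the degree of the characteristic polynomial. -/
theorem isNonderogatory_coordRep {n : ℕ} (b : Module.Dual ℝ A ≃ₗ[ℝ] (Fin n → ℝ))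
    (pb : PowerBasis ℝ A) (hn : pb.dim = n) : IsNonderogatory (coordRep b pb.gen) := by
  have : FiniteDimensional ℝ A := pb.finite
  have h1 : minpoly ℝ (coordRep b pb.gen) = minpoly ℝ pb.gen :=
    minpoly.algHom_eq _ (coordRep_injective b) _
  refine (Polynomial.eq_of_monic_of_dvd_of_natDegree_le
    (minpoly.monic (Algebra.IsIntegral.isIntegral _)) (LinearMap.charpoly_monic _)
    (minpoly.dvd _ _ (LinearMap.aeval_self_charpoly _)) ?_)
  rw [LinearMap.charpoly_natDegree, h1, pb.natDegree_minpoly, Module.finrank_fin_fun, hn]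

theorem exists_nonderogatory_isCotangent (pb : PowerBasis ℝ A) {n : ℕ} (hn : pb.dim = n) :
    ∃ ψ : Module.End ℝ (Fin n → ℝ), IsNonderogatory ψ ∧ IsCotangent (GPoly ψ) A := by
  subst hn
  exact ⟨_, isNonderogatory_coordRep pb.dualCoords pb rfl,
    isCotangent_gPoly pb.dualCoords pb.adjoin_gen_eq_top⟩

/-- In the coordinates `f (x ^ i)`, the transpose of multiplication by `x` shifts the index by one,
and the last entry is `f (x ^ n) = 0`: this is the principal nilpotent matrix. -/
theorem isCotangent_dZero (pb : PowerBasis ℝ A) {n : ℕ} (hn : pb.dim = n)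
    (h0 : pb.gen ^ n = 0) : IsCotangent (DZero n) A := by
  subst hn
  have h : principalNilpotent pb.dim = coordRep pb.dualCoords pb.gen := by
    refine LinearMap.ext fun v => ?_
    obtain ⟨f, rfl⟩ := pb.dualCoords.surjective v
    ext i
    rw [coordRep_apply, PowerBasis.dualCoords_apply, dualMulLeft_apply, ← pow_succ',
      principalNilpotent, Matrix.toLin'_apply, Matrix.mulVec, dotProduct]
    simp only [Matrix.of_apply, ite_mul, one_mul, zero_mul, PowerBasis.dualCoords_apply]
    by_cases hi : (i : ℕ) + 1 < pb.dim
    · rw [Finset.sum_eq_single ⟨i + 1, hi⟩ (fun j _ hj => if_neg fun hj' => hj (Fin.ext hj'.symm))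
        (by simp)]
      simp
    · rw [Finset.sum_eq_zero fun j _ => if_neg (by have := j.2; omega),
        show (i : ℕ) + 1 = pb.dim by have := i.2; omega, h0, map_zero]
  change IsCotangent (GPoly (principalNilpotent pb.dim)) A
  rw [h]
  exact isCotangent_gPoly pb.dualCoords pb.adjoin_gen_eq_top

/-- In the coordinates `f (b i)`, the transpose of multiplication by `b 1` sends `(f₀, f₁, f₂)` to
`(f₁, 0, 0)`, which is `E_{1,2}`; likewise `b 2` gives `E_{1,3}`. -/
theorem isCotangent_g31 (b : Module.Basis (Fin 3) ℝ A) (h0 : b 0 = 1)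
    (h11 : b 1 * b 1 = 0) (h12 : b 1 * b 2 = 0) (h22 : b 2 * b 2 = 0) : IsCotangent G31 A := by
  let c : Module.Dual ℝ A ≃ₗ[ℝ] (Fin 3 → ℝ) := (b.constr ℝ).symm
  have hc : ∀ f i, c f i = f (b i) := fun _ _ => rfl
  have h21 : b 2 * b 1 = 0 := by rw [mul_comm, h12]
  have e1 : coordRep c (b 1) = Matrix.toLin' (Matrix.single (0 : Fin 3) (1 : Fin 3) (1 : ℝ)) := by
    refine LinearMap.ext fun v => ?_
    obtain ⟨f, rfl⟩ := c.surjective v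
    ext i
    rw [coordRep_apply, hc, dualMulLeft_apply]
    fin_cases i <;> simp [h0, h11, h12, hc, Matrix.mulVec, dotProduct, Matrix.single_apply]
  have e2 : coordRep c (b 2) = Matrix.toLin' (Matrix.single (0 : Fin 3) (2 : Fin 3) (1 : ℝ)) := by
    refine LinearMap.ext fun v => ?_
    obtain ⟨f, rfl⟩ := c.surjective v
    ext i
    rw [coordRep_apply, hc, dualMulLeft_apply]
    fin_cases i <;> simp [h0, h21, h22, hc, Matrix.mulVec, dotProduct, Matrix.single_apply]
  refine isCotangent_semidirectRn c _ fun x => ?_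
  change x ∈ Submodule.span ℝ _ ↔ _
  rw [Submodule.mem_span_triple, ← e1, ← e2, ← map_one (coordRep c), ← h0]
  constructor
  · rintro ⟨p, q, r, rfl⟩
    exact ⟨p • b 0 + q • b 1 + r • b 2, by simp⟩
  · rintro ⟨a, rfl⟩
    refine ⟨b.repr a 0, b.repr a 1, b.repr a 2, ?_⟩
    conv_rhs => rw [← b.sum_repr a, Fin.sum_univ_three]
    simp

end CoordinateModel

/-! ### Real commutative algebras of dimension at most 3 -/

section AlgebraClassification

universe u

theorem exists_powerBasis {A : Type*} [CommRing A] [Algebra ℝ A] {n : ℕ} [NeZero n] {x : A}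
    (hx : LinearIndependent ℝ fun i : Fin n => x ^ (i : ℕ)) (hn : Module.finrank ℝ A = n) :
    ∃ pb : PowerBasis ℝ A, pb.gen = x ∧ pb.dim = n :=
  ⟨{ gen := x
     dim := n
     basis := basisOfLinearIndependentOfCardEqFinrank hx (by simp [hn])
     basis_eq_pow := by simp }, rfl, rfl⟩

theorem exists_powerBasis_two {A : Type*} [CommRing A] [Algebra ℝ A] {x : A}
    (hx : ∀ a b : ℝ, a • (1 : A) + b • x = 0 → a = 0 ∧ b = 0) (hn : Module.finrank ℝ A = 2) :
    ∃ pb : PowerBasis ℝ A, pb.gen = x ∧ pb.dim = 2 := by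
  refine exists_powerBasis ?_ hn
  rw [Fintype.linearIndependent_iff]
  intro g hg
  simp only [Fin.sum_univ_two, Fin.val_zero, Fin.val_one, pow_zero, pow_one] at hg
  intro i
  fin_cases i
  · exact (hx _ _ hg).1
  · exact (hx _ _ hg).2

theorem exists_powerBasis_three {A : Type*} [CommRing A] [Algebra ℝ A] {x : A}
    (hx : ∀ a b c : ℝ, a • (1 : A) + b • x + c • x ^ 2 = 0 → a = 0 ∧ b = 0 ∧ c = 0)
    (hn : Module.finrank ℝ A = 3) :
    ∃ pb : PowerBasis ℝ A, pb.gen = x ∧ pb.dim = 3 := by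
  refine exists_powerBasis ?_ hn
  rw [Fintype.linearIndependent_iff]
  intro g hg
  simp only [Fin.sum_univ_three, Fin.val_zero, Fin.val_one, Fin.val_two, pow_zero, pow_one] at hg
  intro i
  fin_cases i
  · exact (hx _ _ _ hg).1
  · exact (hx _ _ _ hg).2.1
  · exact (hx _ _ _ hg).2.2

theorem nonempty_algEquiv_real {A : Type*} [CommRing A] [Algebra ℝ A]
    (h : Module.finrank ℝ A = 1) : Nonempty (A ≃ₐ[ℝ] ℝ) := by
  have : Nontrivial A := Module.nontrivial_of_finrank_pos (R := ℝ) (by omega)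
  have : FiniteDimensional ℝ A := Module.finite_of_finrank_pos (by omega)
  have hinj : Function.Injective (Algebra.ofId ℝ A).toLinearMap := (algebraMap ℝ A).injective
  have hsurj := (LinearMap.injective_iff_surjective_of_finrank_eq_finrank (by simp [h])).1 hinj
  exact ⟨(AlgEquiv.ofBijective (Algebra.ofId ℝ A) ⟨hinj, hsurj⟩).symm⟩

theorem exists_powerBasis_one {A : Type*} [CommRing A] [Algebra ℝ A]
    (h : Module.finrank ℝ A = 1) : ∃ pb : PowerBasis ℝ A, pb.dim = 1 := by
  have : Nontrivial A := Module.nontrivial_of_finrank_pos (R := ℝ) (by omega)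
  -- Only the power `x ^ 0 = 1` enters the basis, so `x = 0` serves as generator.
  obtain ⟨pb, -, hpb⟩ := exists_powerBasis (n := 1) (x := (0 : A)) (by
    rw [Fintype.linearIndependent_iff]
    intro g hg i
    fin_cases i
    simpa using hg) h
  exact ⟨pb, hpb⟩

/-- An idempotent other than `0` and `1` splits the algebra. -/
theorem exists_algEquiv_prod {A : Type u} [CommRing A] [Algebra ℝ A] [FiniteDimensional ℝ A]
    {e : A} (he : IsIdempotentElem e) (h0 : e ≠ 0) (h1 : e ≠ 1) :
    ∃ I J : Ideal A, 0 < Module.finrank ℝ (A ⧸ I) ∧ 0 < Module.finrank ℝ (A ⧸ J) ∧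
      Module.finrank ℝ A = Module.finrank ℝ (A ⧸ I) + Module.finrank ℝ (A ⧸ J) ∧
      Nonempty (A ≃ₐ[ℝ] (A ⧸ I) × (A ⧸ J)) := by
  have key : ∀ f : A, IsIdempotentElem f → f ≠ 1 →
      0 < Module.finrank ℝ (A ⧸ Ideal.span {f}) := by
    intro f hf hf1
    have : Nontrivial (A ⧸ Ideal.span {f}) := by
      rw [Ideal.Quotient.nontrivial_iff, Ne, Ideal.span_singleton_eq_top]
      intro hu
      exact hf1 (hu.mul_left_cancel (by rw [hf.eq, mul_one]))
    exact Module.finrank_pos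
  let φ := AlgEquiv.prodQuotientOfIsIdempotentElem ℝ he he.one_sub (by simp)
    (by rw [mul_sub, he.eq, mul_one, sub_self])
  refine ⟨_, _, key e he h1, key (1 - e) he.one_sub (by simpa using h0), ?_, ⟨φ⟩⟩
  rw [φ.toLinearEquiv.finrank_eq, Module.finrank_prod]

/-- Completing the square in a quadratic extension. -/
theorem exists_sq_eq {A : Type*} [CommRing A] [Algebra ℝ A] {x : A} {p q : ℝ}
    (h : x ^ 2 = p • (1 : A) + q • x) : ∃ s t : ℝ, s ≠ 0 ∧
      ((s • x + t • (1 : A)) ^ 2 = 0 ∨ (s • x + t • (1 : A)) ^ 2 = 1 ∨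
        (s • x + t • (1 : A)) ^ 2 = -1) := by
  have key : ∀ s : ℝ, (s • x + (-s * q / 2) • (1 : A)) ^ 2 =
      (s ^ 2 * (p + q ^ 2 / 4)) • (1 : A) := by
    intro s
    have : (s • x + (-s * q / 2) • (1 : A)) ^ 2 =
        s ^ 2 • x ^ 2 + (-s ^ 2 * q) • x + (s ^ 2 * q ^ 2 / 4) • (1 : A) := by
      simp only [sq, add_mul, mul_add, smul_mul_assoc, mul_smul_comm, mul_one, one_mul]
      module
    rw [this, h]
    module
  -- `p + q ^ 2 / 4` is a quarter of the discriminant; `s` rescales its absolute value to 1 when it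
  -- is nonzero.
  rcases lt_trichotomy (p + q ^ 2 / 4) 0 with hd | hd | hd
  · have hs := Real.sqrt_pos.2 (neg_pos.2 hd)
    refine ⟨(√(-(p + q ^ 2 / 4)))⁻¹, _, inv_ne_zero hs.ne', Or.inr (Or.inr ((key _).trans ?_))⟩
    rw [inv_pow, Real.sq_sqrt (neg_pos.2 hd).le, inv_neg, neg_mul, inv_mul_cancel₀ hd.ne, neg_smul,
      one_smul]
  · exact ⟨1, _, one_ne_zero, Or.inl ((key 1).trans (by rw [hd, mul_zero, zero_smul]))⟩
  · have hs := Real.sqrt_pos.2 hd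
    refine ⟨(√(p + q ^ 2 / 4))⁻¹, _, inv_ne_zero hs.ne', Or.inr (Or.inl ((key _).trans ?_))⟩
    rw [inv_pow, Real.sq_sqrt hd.le, inv_mul_cancel₀ hd.ne', one_smul]

theorem exists_powerBasis_of_finrank_two {A : Type*} [CommRing A] [Algebra ℝ A]
    (h : Module.finrank ℝ A = 2) : ∃ pb : PowerBasis ℝ A, pb.dim = 2 := by
  have : Nontrivial A := Module.nontrivial_of_finrank_pos (R := ℝ) (by omega)
  have : ∃ x : A, x ∉ Submodule.span ℝ {(1 : A)} := by
    by_contra! hx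
    have h1 := finrank_span_singleton (K := ℝ) (one_ne_zero : (1 : A) ≠ 0)
    have h2 : Submodule.span ℝ {(1 : A)} = ⊤ := eq_top_iff.2 fun x _ => hx x
    rw [h2, finrank_top] at h1
    omega
  obtain ⟨x, hx⟩ := this
  obtain ⟨pb, -, hpb⟩ := exists_powerBasis_two (x := x) (fun a b hab => by
    have hb : b = 0 := by
      by_contra hb
      refine hx (Submodule.mem_span_singleton.2 ⟨-a / b, ?_⟩)
      rw [← sub_eq_zero, ← smul_right_injective A hb |>.eq_iff]
      simp only [smul_sub, smul_smul, mul_div_cancel₀ _ hb, smul_zero]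
      rw [neg_smul, sub_eq_zero, eq_comm, eq_neg_iff_add_eq_zero, add_comm]
      exact hab
    subst hb
    simpa using hab) h
  exact ⟨pb, hpb⟩

theorem PowerBasis.exists_eq_smul_add_smul {A : Type*} [CommRing A] [Algebra ℝ A]
    (pb : PowerBasis ℝ A) (h : pb.dim = 2) (y : A) :
    ∃ p q : ℝ, y = p • (1 : A) + q • pb.gen := by
  have hy := pb.basis.mem_span y
  rw [pb.coe_basis] at hy
  have : Set.range (fun i : Fin pb.dim => pb.gen ^ (i : ℕ)) ⊆ {1, pb.gen} := by
    rintro _ ⟨⟨i, hi⟩, rfl⟩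
    obtain rfl | rfl : i = 0 ∨ i = 1 := by omega
    · simp
    · simp
  obtain ⟨p, q, hpq⟩ := Submodule.mem_span_pair.1 (Submodule.span_mono this hy)
  exact ⟨p, q, hpq.symm⟩

theorem PowerBasis.eq_zero_of_smul_add_smul {A : Type*} [CommRing A] [Algebra ℝ A]
    (pb : PowerBasis ℝ A) (h : pb.dim = 2) {a b : ℝ} (hab : a • (1 : A) + b • pb.gen = 0) :
    a = 0 ∧ b = 0 := by
  have hli := pb.basis.linearIndependent
  rw [pb.coe_basis] at hli
  have := (hli.comp (finCongr h.symm) (finCongr h.symm).injective)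
  rw [Fintype.linearIndependent_iff] at this
  have := this ![a, b] (by simpa [Fin.sum_univ_two] using hab)
  exact ⟨this 0, this 1⟩

/-- A generator `y` can be normalised so that `y ^ 2` is `0`, `1` or `-1`. For `1`, the idempotent
`(1 + y) / 2` splits the algebra; for `-1`, `y` plays the role of `i`. -/
theorem classification_finrank_two {A : Type u} [CommRing A] [Algebra ℝ A]
    (h : Module.finrank ℝ A = 2) :
    Nonempty (A ≃ₐ[ℝ] ℝ × ℝ) ∨ Nonempty (A ≃ₐ[ℝ] ℂ) ∨
      ∃ pb : PowerBasis ℝ A, pb.dim = 2 ∧ pb.gen ^ 2 = 0 := by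
  have : FiniteDimensional ℝ A := Module.finite_of_finrank_pos (by omega)
  have : Nontrivial A := Module.nontrivial_of_finrank_pos (R := ℝ) (by omega)
  obtain ⟨pb, hpb⟩ := exists_powerBasis_of_finrank_two h
  obtain ⟨p, q, hpq⟩ := pb.exists_eq_smul_add_smul hpb (pb.gen ^ 2)
  obtain ⟨s, t, hs, hst⟩ := exists_sq_eq hpq
  set y := s • pb.gen + t • (1 : A) with hy
  have hind : ∀ a b : ℝ, a • (1 : A) + b • y = 0 → a = 0 ∧ b = 0 := by
    intro a b hab
    have h1 : (a + b * t) • (1 : A) + (b * s) • pb.gen = 0 := by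
      rw [← hab, hy]; module
    obtain ⟨h2, h3⟩ := pb.eq_zero_of_smul_add_smul hpb h1
    have hb : b = 0 := (mul_eq_zero.1 h3).resolve_right hs
    subst hb
    simpa using h2
  rcases hst with h0 | h1 | h1
  · obtain ⟨pb', h2, h3⟩ := exists_powerBasis_two hind h
    exact Or.inr (Or.inr ⟨pb', h3, by rw [h2, h0]⟩)
  · left
    have he : IsIdempotentElem ((1 / 2 : ℝ) • (1 : A) + (1 / 2 : ℝ) • y) := by
      have : y * y = 1 := by rw [← sq, h1]
      simp only [IsIdempotentElem, add_mul, mul_add, smul_mul_assoc, mul_smul_comm, mul_one,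
        one_mul, this]
      module
    obtain ⟨I, J, hI, hJ, hIJ, ⟨φ⟩⟩ := exists_algEquiv_prod he
      (fun h0 => by simpa using (hind _ _ h0).2)
      (fun h0 => by
        have : (-1 / 2 : ℝ) • (1 : A) + (1 / 2 : ℝ) • y = 0 := by
          rw [← sub_eq_zero] at h0
          rw [← h0]; module
        simpa using (hind _ _ this).2)
    obtain ⟨f⟩ := nonempty_algEquiv_real (A := A ⧸ I) (by omega)
    obtain ⟨g⟩ := nonempty_algEquiv_real (A := A ⧸ J) (by omega)
    exact ⟨φ.trans (AlgEquiv.prodCongr f g)⟩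
  · right; left
    let f := Complex.liftAux y (by rw [← sq, h1])
    have hinj : Function.Injective f.toLinearMap := f.toRingHom.injective
    have hsurj := (LinearMap.injective_iff_surjective_of_finrank_eq_finrank
      (by rw [Complex.finrank_real_complex, h])).1 hinj
    exact ⟨(AlgEquiv.ofBijective f ⟨hinj, hsurj⟩).symm⟩

/-- The product of a quadratic algebra with `ℝ` is generated by one element. -/
theorem exists_powerBasis_prod_real {A : Type*} [CommRing A] [Algebra ℝ A]
    (h : Module.finrank ℝ A = 2) : ∃ pb : PowerBasis ℝ (A × ℝ), pb.dim = 3 := by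
  have : FiniteDimensional ℝ A := Module.finite_of_finrank_pos (by omega)
  obtain ⟨pb, hpb⟩ := exists_powerBasis_of_finrank_two h
  obtain ⟨p, q, hpq⟩ := pb.exists_eq_smul_add_smul hpb (pb.gen ^ 2)
  -- Choosing `r` off the roots of `X² - qX - p` makes the pair `(pb.gen, r)` satisfy no quadratic
  -- relation; any large enough `r` will do.
  obtain ⟨r, hr⟩ : ∃ r : ℝ, r ^ 2 - p - q * r ≠ 0 := by
    refine ⟨|p| + |q| + 1, ne_of_gt ?_⟩
    nlinarith [le_abs_self p, le_abs_self q, abs_nonneg p, abs_nonneg q,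
      mul_nonneg (sub_nonneg.2 (le_abs_self q)) (by positivity : 0 ≤ |p| + |q| + 1)]
  obtain ⟨pb', -, hpb'⟩ := exists_powerBasis_three (x := ((pb.gen, r) : A × ℝ))
    (fun a b c habc => by
      have h1 : a • (1 : A) + b • pb.gen + c • pb.gen ^ 2 = 0 := congrArg Prod.fst habc
      have h2 : a * 1 + b * r + c * r ^ 2 = 0 := congrArg Prod.snd habc
      have h3 : (a + c * p) • (1 : A) + (b + c * q) • pb.gen = 0 := by
        rw [← h1, hpq]; module
      obtain ⟨h4, h5⟩ := pb.eq_zero_of_smul_add_smul hpb h3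
      have hc : c = 0 := by
        have : c * (r ^ 2 - p - q * r) = 0 := by linear_combination h2 - h4 - r * h5
        exact (mul_eq_zero.1 this).resolve_right hr
      subst hc
      simp at h4 h5
      exact ⟨h4, h5, rfl⟩)
    (by rw [Module.finrank_prod, h, Module.finrank_self])
  exact ⟨pb', hpb'⟩

/-- Fitting's argument: the chain of ideals `(x ^ n)` stabilises, giving `x ^ n = x ^ (n + 1) * y`,
and then `x ^ n * y ^ n` is idempotent. If it is `0`, `x` is nilpotent; if it is `1`, `x` is a unit.
-/
theorem isUnit_or_isNilpotent_of_idempotents {A : Type*} [CommRing A] [Algebra ℝ A]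
    [FiniteDimensional ℝ A] (h : ∀ e : A, IsIdempotentElem e → e = 0 ∨ e = 1) (x : A) :
    IsUnit x ∨ IsNilpotent x := by
  have : IsArtinianRing A := IsArtinianRing.of_finite ℝ A
  obtain ⟨n, y, hy⟩ := IsArtinian.exists_pow_succ_smul_dvd x (1 : A)
  replace hy : x ^ (n + 1) * y = x ^ n := by simpa using hy
  have hstep : ∀ k, x ^ n = x ^ (n + k) * y ^ k := by
    intro k
    induction k with
    | zero => simp
    | succ k ih =>
      calc x ^ n = x ^ (n + k) * y ^ k := ih
        _ = x ^ n * (x ^ k * y ^ k) := by ring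
        _ = x ^ (n + 1) * y * (x ^ k * y ^ k) := by rw [hy]
        _ = _ := by ring
  have hn := hstep n
  rcases h (x ^ n * y ^ n) (by
    calc x ^ n * y ^ n * (x ^ n * y ^ n) = x ^ (n + n) * y ^ n * y ^ n := by ring
      _ = x ^ n * y ^ n := by rw [← hn]) with h0 | h1
  · right
    refine ⟨n, ?_⟩
    calc x ^ n = x ^ (n + n) * y ^ n := hn
      _ = x ^ n * (x ^ n * y ^ n) := by ring
      _ = 0 := by rw [h0, mul_zero]
  · rcases Nat.eq_zero_or_pos n with rfl | hpos
    · left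
      exact IsUnit.of_mul_eq_one y (by simpa using hy)
    · left
      rw [← mul_pow] at h1
      exact isUnit_of_mul_isUnit_left ((isUnit_pow_iff hpos.ne').1 (h1 ▸ isUnit_one))

theorem pow_finrank_eq_zero_of_isNilpotent {A : Type*} [CommRing A] [Algebra ℝ A]
    [FiniteDimensional ℝ A] {x : A} (hx : IsNilpotent x) : x ^ Module.finrank ℝ A = 0 := by
  have h1 : IsNilpotent (Algebra.lmul ℝ A x) := hx.map _
  have h2 := (Algebra.lmul ℝ A x).aeval_self_charpoly
  rw [h1.charpoly_eq_X_pow_finrank, map_pow, Polynomial.aeval_X, ← map_pow] at h2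
  simpa using LinearMap.congr_fun h2 1

/-- Multiplication by `x` has a characteristic polynomial of odd degree 3, hence a real eigenvalue.
Subtracting it gives a zero divisor, which is not a unit and so is nilpotent. -/
theorem exists_isNilpotent_sub {A : Type*} [CommRing A] [Algebra ℝ A]
    (h3 : Module.finrank ℝ A = 3) (h : ∀ e : A, IsIdempotentElem e → e = 0 ∨ e = 1) (x : A) :
    ∃ r : ℝ, IsNilpotent (x - r • (1 : A)) := by
  have : FiniteDimensional ℝ A := Module.finite_of_finrank_pos (by omega)
  have hdeg : Polynomial.IsMonicOfDegree (Algebra.lmul ℝ A x).charpoly (1 + 2) :=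
    ⟨by rw [LinearMap.charpoly_natDegree, h3], LinearMap.charpoly_monic _⟩
  obtain ⟨f, g, -, hg, hfg⟩ := hdeg.eq_isMonicOfDegree_two_mul_isMonicOfDegree
  obtain ⟨r, rfl⟩ := Polynomial.isMonicOfDegree_one_iff.1 hg
  have hroot : (Algebra.lmul ℝ A x).charpoly.IsRoot (-r) := by
    rw [hfg]
    simp
  obtain ⟨v, hv⟩ :=
    ((Module.End.hasEigenvalue_iff_isRoot_charpoly _ _).2 hroot).exists_hasEigenvector
  refine ⟨-r, (isUnit_or_isNilpotent_of_idempotents h _).resolve_left fun hu => hv.2 ?_⟩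
  refine hu.mul_right_eq_zero.1 ?_
  have := hv.apply_eq_smul
  simp only [Algebra.coe_lmul_eq_mul, LinearMap.mul_apply_apply] at this
  rw [sub_mul, this, smul_mul_assoc, one_mul, sub_self]

theorem exists_basis_of_sq_eq_zero {A : Type*} [CommRing A] [Algebra ℝ A]
    (h3 : Module.finrank ℝ A = 3) (h : ∀ x : A, ∃ r : ℝ, IsNilpotent (x - r • (1 : A)))
    (hsq : ∀ y : A, IsNilpotent y → y ^ 2 = 0) :
    ∃ b : Module.Basis (Fin 3) ℝ A, b 0 = 1 ∧ b 1 * b 1 = 0 ∧ b 1 * b 2 = 0 ∧ b 2 * b 2 = 0 := by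
  classical
  have hsmall : ∀ a b : A, ∃ x : A, x ∉ Submodule.span ℝ {a, b} := by
    intro a b
    by_contra! hx
    have h1 : Submodule.span ℝ {a, b} = ⊤ := eq_top_iff.2 fun x _ => hx x
    have h2 := finrank_span_finset_le_card (R := ℝ) ({a, b} : Finset A)
    rw [Finset.coe_pair, Set.finrank, h1, finrank_top, h3] at h2
    have := Finset.card_le_two (a := a) (b := b)
    omega
  obtain ⟨x, hx⟩ := hsmall 1 1
  obtain ⟨r, hr⟩ := h x
  set y := x - r • (1 : A) with hy
  have hy0 : y ≠ 0 := by
    intro h0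
    rw [hy, sub_eq_zero] at h0
    rw [h0] at hx
    exact hx (Submodule.smul_mem _ _ (Submodule.subset_span (by simp)))
  obtain ⟨x', hx'⟩ := hsmall 1 y
  obtain ⟨r', hr'⟩ := h x'
  set z := x' - r' • (1 : A) with hz
  have hyy := hsq y hr
  have hzz := hsq z hr'
  -- Polarisation: `y + z` is nilpotent too, so its square vanishes.
  have hyz : y * z = 0 := by
    have h1 := hsq (y + z) ((Commute.all y z).isNilpotent_add hr hr')
    have h2 : (2 : ℝ) • (y * z) = 0 := by
      rw [two_smul]
      linear_combination h1 - hyy - hzz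
    exact (smul_eq_zero.1 h2).resolve_left two_ne_zero
  have hli : LinearIndependent ℝ ![1, y, z] := by
    rw [Fintype.linearIndependent_iff]
    intro g hg
    simp only [Fin.sum_univ_three, Matrix.cons_val] at hg
    have hg2 : g 2 = 0 := by
      by_contra hc
      refine hx' (Submodule.mem_span_pair.2 ⟨r' - g 0 / g 2, -g 1 / g 2, ?_⟩)
      have h1 : z = -(g 2)⁻¹ • (g 0 • (1 : A) + g 1 • y) := by
        rw [eq_neg_of_add_eq_zero_left hg, neg_smul, smul_neg, neg_neg, inv_smul_smul₀ hc]
      rw [show x' = z + r' • (1 : A) by rw [hz]; abel, h1]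
      module
    rw [hg2, zero_smul, add_zero] at hg
    have hg0 : g 0 = 0 := by
      have h1 : g 0 • y = 0 := by
        have h2 : (g 0 • (1 : A) + g 1 • y) * y = 0 := by rw [hg, zero_mul]
        rwa [add_mul, smul_mul_assoc, smul_mul_assoc, ← sq, hyy, smul_zero, add_zero, one_mul]
          at h2
      exact (smul_eq_zero.1 h1).resolve_right hy0
    rw [hg0, zero_smul, zero_add] at hg
    have hg1 : g 1 = 0 := (smul_eq_zero.1 hg).resolve_right hy0
    intro i
    fin_cases i <;> assumption
  refine ⟨basisOfLinearIndependentOfCardEqFinrank hli (by simp [h3]), ?_⟩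
  simp [← sq, hyy, hzz, hyz]

/-- Commutativity of the product of algebras. -/
def algEquivProdComm {A B : Type*} [CommRing A] [Algebra ℝ A] [CommRing B] [Algebra ℝ B] :
    (A × B) ≃ₐ[ℝ] B × A :=
  AlgEquiv.ofRingEquiv (f := RingEquiv.prodComm) fun _ => rfl

/-- A nontrivial idempotent splits off a factor `ℝ`. Otherwise every element is a scalar plus a
nilpotent: a nilpotent `y` with `y ^ 2 ≠ 0` generates, and if there is none, all products of
nilpotents vanish. -/
theorem classification_finrank_three {A : Type u} [CommRing A] [Algebra ℝ A]
    (h3 : Module.finrank ℝ A = 3) :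
    (∃ I : Ideal A, Module.finrank ℝ (A ⧸ I) = 2 ∧ Nonempty (A ≃ₐ[ℝ] (A ⧸ I) × ℝ)) ∨
      (∃ pb : PowerBasis ℝ A, pb.dim = 3 ∧ pb.gen ^ 3 = 0) ∨
      ∃ b : Module.Basis (Fin 3) ℝ A,
        b 0 = 1 ∧ b 1 * b 1 = 0 ∧ b 1 * b 2 = 0 ∧ b 2 * b 2 = 0 := by
  have : FiniteDimensional ℝ A := Module.finite_of_finrank_pos (by omega)
  by_cases h : ∀ e : A, IsIdempotentElem e → e = 0 ∨ e = 1
  · right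
    by_cases hsq : ∀ y : A, IsNilpotent y → y ^ 2 = 0
    · exact Or.inr (exists_basis_of_sq_eq_zero h3 (exists_isNilpotent_sub h3 h) hsq)
    · left
      push Not at hsq
      obtain ⟨y, hy, hy2⟩ := hsq
      have hy3 : y ^ 3 = 0 := h3 ▸ pow_finrank_eq_zero_of_isNilpotent hy
      -- Since `y ^ 3 = 0`, multiplying a relation by `y ^ 2` isolates `a`, and then multiplying by
      -- `y` isolates `b`.
      obtain ⟨pb, h1, h2⟩ := exists_powerBasis_three (x := y) (fun a b c habc => by
        have ha : a = 0 := by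
          have h1 : a • y ^ 2 = 0 := by
            have h2 : (a • (1 : A) + b • y + c • y ^ 2) * y ^ 2 = 0 := by rw [habc, zero_mul]
            simp only [Algebra.smul_def] at h2 ⊢
            linear_combination h2 - (algebraMap ℝ A b + algebraMap ℝ A c * y) * hy3
          exact (smul_eq_zero.1 h1).resolve_right hy2
        have hb : b = 0 := by
          have h1 : b • y ^ 2 = 0 := by
            have h2 : (a • (1 : A) + b • y + c • y ^ 2) * y = 0 := by rw [habc, zero_mul]
            rw [ha] at h2
            simp only [Algebra.smul_def, map_zero] at h2 ⊢
            linear_combination h2 - algebraMap ℝ A c * hy3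
          exact (smul_eq_zero.1 h1).resolve_right hy2
        rw [ha, hb, zero_smul, zero_smul, zero_add, zero_add] at habc
        exact ⟨ha, hb, (smul_eq_zero.1 habc).resolve_right hy2⟩) h3
      exact ⟨pb, h2, by rw [h1, hy3]⟩
  · left
    push Not at h
    obtain ⟨e, he, h0, h1⟩ := h
    obtain ⟨I, J, hI, hJ, hIJ, ⟨φ⟩⟩ := exists_algEquiv_prod he h0 h1
    obtain hI' | hJ' : Module.finrank ℝ (A ⧸ I) = 1 ∨ Module.finrank ℝ (A ⧸ J) = 1 := by omega
    · obtain ⟨f⟩ := nonempty_algEquiv_real hI'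
      exact ⟨J, by omega, ⟨(φ.trans (AlgEquiv.prodCongr f .refl)).trans algEquivProdComm⟩⟩
    · obtain ⟨f⟩ := nonempty_algEquiv_real hJ'
      exact ⟨I, by omega, ⟨φ.trans (AlgEquiv.prodCongr .refl f)⟩⟩

end AlgebraClassification

/-! ### From algebras back to Lie algebras -/

theorem isCotangent_aff_real : IsCotangent (aff ℝ) ℝ :=
  isCotangent_aff ℝ LinearMap.id one_ne_zero

theorem isCotangent_aff_complex : IsCotangent (aff ℂ) ℂ :=
  isCotangent_aff ℂ Complex.reLm (by simp)

/-- The two-dimensional algebras give `aff(ℝ) ⊕ aff(ℝ)`, `aff(ℂ)` and `𝔇₀²`. -/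
theorem isCotangent_of_finrank_two {A : Type*} [CommRing A] [Algebra ℝ A]
    (h : Module.finrank ℝ A = 2) :
    IsCotangent (aff ℝ × aff ℝ) A ∨ IsCotangent (aff ℂ) A ∨ IsCotangent (DZero 2) A := by
  rcases classification_finrank_two h with ⟨⟨φ⟩⟩ | ⟨⟨φ⟩⟩ | ⟨pb, hpb, h0⟩
  · exact Or.inl ((isCotangent_aff_real.prod isCotangent_aff_real).congr φ.symm)
  · exact Or.inr (Or.inl (isCotangent_aff_complex.congr φ.symm))
  · exact Or.inr (Or.inr (isCotangent_dZero pb hpb h0))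

theorem IsCotangent.classification {G A : Type*} [LieRing G] [LieAlgebra ℝ G] [CommRing A]
    [Algebra ℝ A] [FiniteDimensional ℝ A] [Nontrivial A] (hG : IsCotangent G A)
    (hA : Module.finrank ℝ A ≤ 3) :
    (∃ n : ℕ, Module.finrank ℝ G = 2 * n ∧
      ((∃ ψ : Module.End ℝ (Fin n → ℝ), IsNonderogatory ψ ∧ Nonempty (G ≃ₗ⁅ℝ⁆ GPoly ψ)) ∨
        Nonempty (G ≃ₗ⁅ℝ⁆ G31))) ∧
    (Nonempty (G ≃ₗ⁅ℝ⁆ aff ℝ) ∨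
      Nonempty (G ≃ₗ⁅ℝ⁆ DZero 2) ∨
      Nonempty (G ≃ₗ⁅ℝ⁆ aff ℂ) ∨
      Nonempty (G ≃ₗ⁅ℝ⁆ DZero 3) ∨
      Nonempty (G ≃ₗ⁅ℝ⁆ G31) ∨
      Nonempty (G ≃ₗ⁅ℝ⁆ (aff ℝ × aff ℝ)) ∨
      Nonempty (G ≃ₗ⁅ℝ⁆ (DZero 2 × aff ℝ)) ∨
      Nonempty (G ≃ₗ⁅ℝ⁆ (aff ℂ × aff ℝ)) ∨
      Nonempty (G ≃ₗ⁅ℝ⁆ (aff ℝ × aff ℝ × aff ℝ))) := by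
  have hdim := hG.finrank_eq
  have hpos : 0 < Module.finrank ℝ A := Module.finrank_pos
  have hpoly : ∀ {n : ℕ} (pb : PowerBasis ℝ A), pb.dim = n →
      ∃ ψ : Module.End ℝ (Fin n → ℝ), IsNonderogatory ψ ∧ Nonempty (G ≃ₗ⁅ℝ⁆ GPoly ψ) := by
    intro n pb hn
    obtain ⟨ψ, hψ, h⟩ := exists_nonderogatory_isCotangent pb hn
    exact ⟨ψ, hψ, hG.nonempty_lieEquiv h⟩
  obtain h | h | h : Module.finrank ℝ A = 1 ∨ Module.finrank ℝ A = 2 ∨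
    Module.finrank ℝ A = 3 := by omega
  · obtain ⟨pb, hpb⟩ := exists_powerBasis_one h
    obtain ⟨φ⟩ := nonempty_algEquiv_real h
    exact ⟨⟨1, by rw [hdim, h], Or.inl (hpoly pb hpb)⟩,
      Or.inl (hG.nonempty_lieEquiv (isCotangent_aff_real.congr φ.symm))⟩
  · obtain ⟨pb, hpb⟩ := exists_powerBasis_of_finrank_two h
    refine ⟨⟨2, by rw [hdim, h], Or.inl (hpoly pb hpb)⟩, ?_⟩
    rcases isCotangent_of_finrank_two h with h' | h' | h' <;>
      have := hG.nonempty_lieEquiv h' <;> tauto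
  · rcases classification_finrank_three h with ⟨I, hI, ⟨φ⟩⟩ | ⟨pb, hpb, h0⟩ | ⟨b, h0, h11, h12, h22⟩
    · obtain ⟨pb, hpb⟩ := exists_powerBasis_prod_real hI
      refine ⟨⟨3, by rw [hdim, h], Or.inl (hpoly (pb.map φ.symm) hpb)⟩, ?_⟩
      rcases isCotangent_of_finrank_two hI with h' | h' | h'
      · have := hG.nonempty_lieEquiv
          ((isCotangent_aff_real.prod h').congr (algEquivProdComm.trans φ.symm))
        tauto
      · have := hG.nonempty_lieEquiv ((h'.prod isCotangent_aff_real).congr φ.symm)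
        tauto
      · have := hG.nonempty_lieEquiv ((h'.prod isCotangent_aff_real).congr φ.symm)
        tauto
    · have := hG.nonempty_lieEquiv (isCotangent_dZero pb hpb h0)
      exact ⟨⟨3, by rw [hdim, h], Or.inl (hpoly pb hpb)⟩, by tauto⟩
    · have := hG.nonempty_lieEquiv (isCotangent_g31 b h0 h11 h12 h22)
      exact ⟨⟨3, by rw [hdim, h], Or.inr this⟩, by tauto⟩

theorem mainTheorem7 (G : Type*) [LieRing G] [LieAlgebra ℝ G] [FiniteDimensional ℝ G]
    [Nontrivial G] (hdim : Module.finrank ℝ G ≤ 6)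
    (hsolv : IsTwoStepSolvable G) (hfrob : IsFrobeniusLie G) :
    (∃ n : ℕ, Module.finrank ℝ G = 2 * n ∧
      ((∃ ψ : Module.End ℝ (Fin n → ℝ), IsNonderogatory ψ ∧ Nonempty (G ≃ₗ⁅ℝ⁆ GPoly ψ)) ∨
        Nonempty (G ≃ₗ⁅ℝ⁆ G31))) ∧
    (Nonempty (G ≃ₗ⁅ℝ⁆ aff ℝ) ∨
      Nonempty (G ≃ₗ⁅ℝ⁆ DZero 2) ∨
      Nonempty (G ≃ₗ⁅ℝ⁆ aff ℂ) ∨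
      Nonempty (G ≃ₗ⁅ℝ⁆ DZero 3) ∨
      Nonempty (G ≃ₗ⁅ℝ⁆ G31) ∨
      Nonempty (G ≃ₗ⁅ℝ⁆ (aff ℝ × aff ℝ)) ∨
      Nonempty (G ≃ₗ⁅ℝ⁆ (DZero 2 × aff ℝ)) ∨
      Nonempty (G ≃ₗ⁅ℝ⁆ (aff ℂ × aff ℝ)) ∨
      Nonempty (G ≃ₗ⁅ℝ⁆ (aff ℝ × aff ℝ × aff ℝ))) := by
  obtain ⟨B, A, hcomm, hA⟩ := exists_isCotangent hsolv hfrob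
  -- Built on the existing ring structure of `A`, so that `hA` still refers to the same
  -- multiplication.
  let _ : CommRing A := { (inferInstance : Ring A) with mul_comm := hcomm }
  have hdimG := hA.finrank_eq
  have hpos : 0 < Module.finrank ℝ G := Module.finrank_pos
  have : Nontrivial A := Module.nontrivial_of_finrank_pos (R := ℝ) (by omega)
  exact IsCotangent.classification (A := A) hA (by omega)
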